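/- Let $\mathbb{D}=\{z\in\mathbb{C}:|z|<1\}$ and let $H^2(\mathbb{D})$ be the Hardy space of all holomorphic $f:\mathbb{D}\to\mathbb{C}$ with $$\|f\|_{H^2}^2:=\sup_{0\le r<1}\frac1{2\pi}\int_0^{2\pi}|f(re^{i\theta})|^2\,d\theta<\infty .$$ Let $\varphi:\mathbb{D}\to\mathbb{D}$ be holomorphic. Then the composition operator $C_\varphi f=f\circ\varphi$ maps $H^2(\mathbb{D})$ into itself and is bounded, and its operator norm satisfies $$\|C_\varphi\|\le\left\|\frac{\sqrt{1-|\varphi(0)|^2}}{1-\overline{\varphi(0)}\,\varphi(z)}\right\|_\infty\le\sqrt{\frac{1+|\varphi(0)|}{1-|\varphi(0)|}},$$ where $\|g\|_\infty=\sup_{z\in\mathbb{D}}|g(z)|$ (and this supremum is finite for the function displayed). -/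

import Mathlib

open scoped ComplexConjugate Complex.UnitDisc

noncomputable section

/-- The extension of a function on the open unit disc `𝔻` to `ℂ` by zero. -/
def zeroExtend (f : 𝔻 → ℂ) (z : ℂ) : ℂ :=
  if h : ‖z‖ < 1 then f (Complex.UnitDisc.mk z h) else 0

/-- `f : 𝔻 → ℂ` is holomorphic: it is complex differentiable at every point of the open disc. -/
def IsHolomorphicOnDisc (f : 𝔻 → ℂ) : Prop :=
  DifferentiableOn ℂ (zeroExtend f) (Metric.ball (0 : ℂ) 1)

/-- The mean `(2π)⁻¹ ∫₀^{2π} |f(r e^{iθ})|² dθ` of `|f|²` over the circle of radius `r`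
(used for `0 ≤ r < 1`), i.e. `∫_𝕋 |f(rz)|² dm(z)` for the normalized measure `m`. -/
def squareMean (f : 𝔻 → ℂ) (r : ℝ) : ℝ :=
  Real.circleAverage (fun z => ‖zeroExtend f z‖ ^ 2) 0 r

/-- Membership in `H²(𝔻)`: `f` is holomorphic and `sup_{0 ≤ r < 1} ∫_𝕋 |f(rz)|² dm(z) < ∞`. -/
def MemHardy (f : 𝔻 → ℂ) : Prop :=
  IsHolomorphicOnDisc f ∧ BddAbove (squareMean f '' Set.Ico 0 1)

/-- The `H²` norm `(sup_{0 ≤ r < 1} ∫_𝕋 |f(rz)|² dm(z))^{1/2}`. -/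
def hardyNorm (f : 𝔻 → ℂ) : ℝ :=
  √(sSup (squareMean f '' Set.Ico 0 1))

theorem zeroExtend_add (f g : 𝔻 → ℂ) (z : ℂ) :
    zeroExtend (f + g) z = zeroExtend f z + zeroExtend g z := by
  unfold zeroExtend; split_ifs <;> simp

theorem zeroExtend_smul (c : ℂ) (f : 𝔻 → ℂ) (z : ℂ) :
    zeroExtend (c • f) z = c * zeroExtend f z := by
  unfold zeroExtend; split_ifs <;> simp

theorem zeroExtend_zero (z : ℂ) : zeroExtend 0 z = 0 := by
  unfold zeroExtend; split_ifs <;> simp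

theorem zeroExtend_coe (f : 𝔻 → ℂ) (z : 𝔻) : zeroExtend f (z : ℂ) = f z := by
  unfold zeroExtend; rw [dif_pos z.norm_lt_one]; simp

theorem IsHolomorphicOnDisc.circleIntegrable {f : 𝔻 → ℂ} (hf : IsHolomorphicOnDisc f) {r : ℝ}
    (hr : r ∈ Set.Ico (0 : ℝ) 1) :
    CircleIntegrable (fun z => ‖zeroExtend f z‖ ^ 2) 0 r := by
  apply ContinuousOn.circleIntegrable hr.1
  have h1 : ContinuousOn (zeroExtend f) (Metric.sphere 0 r) :=
    hf.continuousOn.mono fun z hz => by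
      rw [Metric.mem_ball, Metric.mem_sphere.1 hz]; exact hr.2
  exact h1.norm.pow 2

theorem squareMean_nonneg (f : 𝔻 → ℂ) (r : ℝ) : 0 ≤ squareMean f r :=
  Real.circleAverage_nonneg_of_nonneg fun _ _ => by positivity

theorem squareMean_smul (c : ℂ) (f : 𝔻 → ℂ) (r : ℝ) :
    squareMean (c • f) r = ‖c‖ ^ 2 * squareMean f r := by
  unfold squareMean
  rw [← smul_eq_mul, ← Real.circleAverage_fun_smul]
  congr 1; ext z
  rw [zeroExtend_smul, norm_mul, mul_pow, smul_eq_mul]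

theorem hardyNorm_nonneg (f : 𝔻 → ℂ) : 0 ≤ hardyNorm f := Real.sqrt_nonneg _

theorem MemHardy.squareMean_le {f : 𝔻 → ℂ} (hf : MemHardy f) {r : ℝ}
    (hr : r ∈ Set.Ico (0 : ℝ) 1) : squareMean f r ≤ hardyNorm f ^ 2 := by
  have h := le_csSup hf.2 (Set.mem_image_of_mem _ hr)
  rw [hardyNorm, Real.sq_sqrt ((squareMean_nonneg f r).trans h)]
  exact h

theorem hardyNorm_le {f : 𝔻 → ℂ} {C : ℝ} (hC : 0 ≤ C)
    (h : ∀ r ∈ Set.Ico (0 : ℝ) 1, squareMean f r ≤ C ^ 2) : hardyNorm f ≤ C := by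
  rw [hardyNorm, Real.sqrt_le_left hC]
  refine csSup_le ⟨_, Set.mem_image_of_mem _ (Set.left_mem_Ico.2 one_pos)⟩ ?_
  rintro _ ⟨r, hr, rfl⟩
  exact h r hr

theorem squareMean_add_le {f g : 𝔻 → ℂ} (hf : IsHolomorphicOnDisc f) (hg : IsHolomorphicOnDisc g)
    {r x y : ℝ} (hr : r ∈ Set.Ico (0 : ℝ) 1) (hx : 0 < x) (hy : 0 < y)
    (hfx : squareMean f r ≤ x ^ 2) (hgy : squareMean g r ≤ y ^ 2) :
    squareMean (f + g) r ≤ (x + y) ^ 2 := by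
  have If := (hf.circleIntegrable hr).const_fun_smul (a := (x + y) / x)
  have Ig := (hg.circleIntegrable hr).const_fun_smul (a := (x + y) / y)
  have hfg : IsHolomorphicOnDisc (f + g) :=
    (DifferentiableOn.add hf hg).congr fun z _ => zeroExtend_add f g z
  have key : squareMean (f + g) r ≤
      (x + y) / x * squareMean f r + (x + y) / y * squareMean g r := by
    unfold squareMean
    rw [← smul_eq_mul, ← smul_eq_mul, ← Real.circleAverage_fun_smul,
      ← Real.circleAverage_fun_smul, ← Real.circleAverage_fun_add If Ig]
    refine Real.circleAverage_mono (hfg.circleIntegrable hr) (If.add Ig) fun z _ => ?_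
    simp only [smul_eq_mul, zeroExtend_add]
    set a := zeroExtend f z
    set b := zeroExtend g z
    have h1 : ‖a + b‖ ^ 2 ≤ (‖a‖ + ‖b‖) ^ 2 := by gcongr; exact norm_add_le a b
    refine h1.trans ?_
    have h2 : (x + y) / x * ‖a‖ ^ 2 + (x + y) / y * ‖b‖ ^ 2 - (‖a‖ + ‖b‖) ^ 2
        = (y * ‖a‖ - x * ‖b‖) ^ 2 / (x * y) := by field_simp; ring
    have h3 : 0 ≤ (y * ‖a‖ - x * ‖b‖) ^ 2 / (x * y) := by positivity
    linarith
  refine key.trans ?_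
  have h1 : (x + y) / x * squareMean f r ≤ (x + y) / x * x ^ 2 := by gcongr
  have h2 : (x + y) / y * squareMean g r ≤ (x + y) / y * y ^ 2 := by gcongr
  have h3 : (x + y) / x * x ^ 2 + (x + y) / y * y ^ 2 = (x + y) ^ 2 := by field_simp
  linarith

theorem MemHardy.squareMean_add_le {f g : 𝔻 → ℂ} (hf : MemHardy f) (hg : MemHardy g) {ε : ℝ}
    (hε : 0 < ε) {r : ℝ} (hr : r ∈ Set.Ico (0 : ℝ) 1) :
    squareMean (f + g) r ≤ (hardyNorm f + hardyNorm g + ε) ^ 2 := by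
  have h1 := hardyNorm_nonneg f
  have h2 := hardyNorm_nonneg g
  have := _root_.squareMean_add_le hf.1 hg.1 hr (x := hardyNorm f + ε / 2)
    (y := hardyNorm g + ε / 2) (by positivity) (by positivity)
    ((hf.squareMean_le hr).trans (by gcongr; linarith))
    ((hg.squareMean_le hr).trans (by gcongr; linarith))
  exact this.trans_eq (by ring)

theorem MemHardy.zero : MemHardy 0 := by
  refine ⟨(differentiableOn_const (0 : ℂ)).congr fun z _ => zeroExtend_zero z, 0, ?_⟩
  rintro _ ⟨r, -, rfl⟩
  have := squareMean_smul 0 0 r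
  simp at this
  exact this.le

theorem MemHardy.add {f g : 𝔻 → ℂ} (hf : MemHardy f) (hg : MemHardy g) : MemHardy (f + g) := by
  refine ⟨(DifferentiableOn.add hf.1 hg.1).congr fun z _ => zeroExtend_add f g z,
    (hardyNorm f + hardyNorm g + 1) ^ 2, ?_⟩
  rintro _ ⟨r, hr, rfl⟩
  exact hf.squareMean_add_le hg one_pos hr

theorem MemHardy.smul {f : 𝔻 → ℂ} (c : ℂ) (hf : MemHardy f) : MemHardy (c • f) := by
  refine ⟨(DifferentiableOn.const_mul hf.1 c).congr fun z _ => zeroExtend_smul c f z,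
    ‖c‖ ^ 2 * hardyNorm f ^ 2, ?_⟩
  rintro _ ⟨r, hr, rfl⟩
  rw [squareMean_smul]
  gcongr
  exact hf.squareMean_le hr

theorem hardyNorm_add_le {f g : 𝔻 → ℂ} (hf : MemHardy f) (hg : MemHardy g) :
    hardyNorm (f + g) ≤ hardyNorm f + hardyNorm g := by
  refine le_of_forall_pos_le_add fun ε hε => hardyNorm_le ?_ fun r hr =>
    hf.squareMean_add_le hg hε hr
  have h1 := hardyNorm_nonneg f
  have h2 := hardyNorm_nonneg g
  positivity

theorem hardyNorm_smul_le {f : 𝔻 → ℂ} (c : ℂ) (hf : MemHardy f) :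
    hardyNorm (c • f) ≤ ‖c‖ * hardyNorm f := by
  refine hardyNorm_le (mul_nonneg (norm_nonneg _) (hardyNorm_nonneg f)) fun r hr => ?_
  rw [squareMean_smul, mul_pow]
  gcongr
  exact hf.squareMean_le hr

theorem eq_zero_of_hardyNorm_eq_zero {f : 𝔻 → ℂ} (hf : MemHardy f) (h : hardyNorm f = 0) :
    f = 0 := by
  ext w
  have hw : ‖(w : ℂ)‖ ∈ Set.Ico (0 : ℝ) 1 := ⟨norm_nonneg _, w.norm_lt_one⟩
  have h0 : squareMean f ‖(w : ℂ)‖ = 0 :=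
    le_antisymm ((hf.squareMean_le hw).trans (by simp [h])) (squareMean_nonneg _ _)
  have hc : Continuous fun θ : ℝ => ‖zeroExtend f (circleMap 0 ‖(w : ℂ)‖ θ)‖ ^ 2 := by
    refine Continuous.pow (Continuous.norm ?_) 2
    refine hf.1.continuousOn.comp_continuous (continuous_circleMap _ _) fun θ => ?_
    rw [mem_ball_zero_iff, norm_circleMap_zero, abs_norm]
    exact w.norm_lt_one
  have hpi := Real.two_pi_pos
  have hint : ∫ θ in (0 : ℝ)..2 * Real.pi,
      ‖zeroExtend f (circleMap 0 ‖(w : ℂ)‖ θ)‖ ^ 2 = 0 := by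
    simpa [squareMean, Real.circleAverage_def, Real.pi_ne_zero] using h0
  have hex : ∃ θ ∈ Set.Icc (0 : ℝ) (2 * Real.pi), circleMap 0 ‖(w : ℂ)‖ θ = (w : ℂ) := by
    have h1 : (w : ℂ) ∈ Metric.sphere (0 : ℂ) |‖(w : ℂ)‖| := by simp
    rw [← image_circleMap_Ioc] at h1
    obtain ⟨θ, hθ, e⟩ := h1
    exact ⟨θ, Set.Ioc_subset_Icc_self hθ, e⟩
  obtain ⟨θ, hθ, e⟩ := hex
  by_contra hne
  have hpos : 0 < ∫ θ in (0 : ℝ)..2 * Real.pi,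
      ‖zeroExtend f (circleMap 0 ‖(w : ℂ)‖ θ)‖ ^ 2 := by
    refine intervalIntegral.integral_pos hpi hc.continuousOn (fun _ _ => by positivity)
      ⟨θ, hθ, ?_⟩
    rw [e, zeroExtend_coe]
    have : f w ≠ 0 := hne
    positivity
  exact hpos.ne' hint

/-- `H²(𝔻)` as a linear subspace of the functions on `𝔻`. -/
def hardySubmodule : Submodule ℂ (𝔻 → ℂ) where
  carrier := {f | MemHardy f}
  add_mem' := MemHardy.add
  zero_mem' := MemHardy.zero
  smul_mem' := fun c _ hf => hf.smul c

/-- The Hardy space `H²(𝔻)`. This is a type synonym, so that it carries the topology of the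
`H²` norm and not that of pointwise convergence. -/
def HardySpace : Type := hardySubmodule

namespace HardySpace

instance : AddCommGroup HardySpace := inferInstanceAs (AddCommGroup hardySubmodule)

instance : Module ℂ HardySpace := inferInstanceAs (Module ℂ hardySubmodule)

instance : CoeFun HardySpace fun _ => 𝔻 → ℂ := ⟨fun f => Subtype.val f⟩

instance : Norm HardySpace := ⟨fun f => hardyNorm f⟩

theorem norm_def (f : HardySpace) : ‖f‖ = hardyNorm f := rfl

theorem memHardy (f : HardySpace) : MemHardy f := Subtype.property f

theorem normedSpaceCore : NormedSpace.Core ℂ HardySpace where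
  norm_nonneg f := hardyNorm_nonneg f
  norm_smul c f := by
    change hardyNorm (c • (f : 𝔻 → ℂ)) = ‖c‖ * hardyNorm f
    refine le_antisymm (hardyNorm_smul_le c f.memHardy) ?_
    rcases eq_or_ne c 0 with rfl | hc
    · simpa using hardyNorm_nonneg _
    have h := hardyNorm_smul_le c⁻¹ (f.memHardy.smul c)
    rw [smul_smul, inv_mul_cancel₀ hc, one_smul, norm_inv] at h
    have hc' : 0 < ‖c‖ := norm_pos_iff.2 hc
    calc ‖c‖ * hardyNorm f ≤ ‖c‖ * (‖c‖⁻¹ * hardyNorm (c • (f : 𝔻 → ℂ))) := by gcongr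
      _ = _ := by field_simp
  norm_triangle f g := hardyNorm_add_le f.memHardy g.memHardy
  norm_eq_zero_iff f := by
    constructor
    · intro h
      exact Subtype.ext (eq_zero_of_hardyNorm_eq_zero f.memHardy h)
    · rintro rfl
      refine le_antisymm (hardyNorm_le le_rfl fun r _ => ?_) (hardyNorm_nonneg _)
      have := squareMean_smul 0 0 r
      simp at this
      exact this.le.trans (by simp)

instance : NormedAddCommGroup HardySpace := NormedAddCommGroup.ofCore normedSpaceCore

instance : NormedSpace ℂ HardySpace := NormedSpace.ofCore normedSpaceCore

end HardySpace

end

/-! Write `a = φ 0`. Littlewood subordination on circles of radius `r` and `R`, with `|φ| < R` on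
`|z| ≤ r`, bounds the mean of `|F ∘ φ|²` by the Poisson integral of `|F|²` at `a`: dominate `|F|²`
inside by its Poisson integral, swap integrals, and use harmonicity of the kernel
(`circleAverage_norm_sq_comp_le`). For `F(z) = (R² - conj a * z) f(z)` the weight cancels the
denominator of the Poisson kernel on `|ζ| = R`, leaving a constant times the plain mean of `|f|²`.
Letting `R → 1` bounds the mean of `|1 - conj a * φ|² |f ∘ φ|²` by `(1 - |a|²) ‖f‖²`. Bounding the
weight below through the displayed supremum gives the operator norm estimate. All circles have
radius below `1`, so no boundary values of `f` are needed. -/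

/-! ### Poisson kernel and Littlewood subordination -/

theorem continuousOn_poissonKernel_sphere {R : ℝ} {w : ℂ} (hw : w ∈ Metric.ball (0 : ℂ) R) :
    ContinuousOn (poissonKernel 0 w) (Metric.sphere 0 R) := by
  have hR : |R| = R := abs_of_pos (Metric.pos_of_mem_ball hw)
  rw [poissonKernel_eq_re_herglotzRieszKernel]
  exact Complex.continuous_re.comp_continuousOn
    (hR ▸ continuousOn_herglotzRieszKernel_sphere hw)

theorem poissonKernel_nonneg {R : ℝ} {w z : ℂ} (hw : w ∈ Metric.ball (0 : ℂ) R)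
    (hz : z ∈ Metric.sphere (0 : ℂ) R) : 0 ≤ poissonKernel 0 w z := by
  rw [mem_ball_zero_iff] at hw
  rw [mem_sphere_zero_iff_norm] at hz
  rw [poissonKernel_def, sub_zero, sub_zero, hz]
  have : ‖w‖ ^ 2 ≤ R ^ 2 := by gcongr
  exact div_nonneg (sub_nonneg.2 this) (by positivity)

/-- The squared modulus of a holomorphic function is at most the Poisson integral of its
boundary values. -/
theorem norm_sq_le_circleAverage_poissonKernel {F : ℂ → ℂ} {R : ℝ} {w : ℂ}
    (hF : DiffContOnCl ℂ F (Metric.ball 0 R)) (hw : w ∈ Metric.ball (0 : ℂ) R) :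
    ‖F w‖ ^ 2 ≤ Real.circleAverage (fun z => poissonKernel 0 w z * ‖F z‖ ^ 2) 0 R := by
  have hR : 0 < R := Metric.pos_of_mem_ball hw
  have hFc : ContinuousOn F (Metric.sphere 0 R) :=
    hF.2.mono (by rw [closure_ball 0 hR.ne']; exact Metric.sphere_subset_closedBall)
  have hP := continuousOn_poissonKernel_sphere hw
  -- Expanding `|F z - F w|² ≥ 0` gives `Re (G z) ≤ |F z|²`, with equality at `z = w`. As `G` is
  -- holomorphic, its Poisson integral reproduces `G w`.
  set G : ℂ → ℂ := fun z => 2 * conj (F w) * F z - conj (F w) * F w with hGdef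
  have hG : DiffContOnCl ℂ G (Metric.ball 0 R) :=
    (hF.const_smul (2 * conj (F w))).sub diffContOnCl_const
  have hGc : ContinuousOn (poissonKernel 0 w • G) (Metric.sphere 0 R) := by
    refine hP.smul ?_
    exact (continuousOn_const.mul hFc).sub continuousOn_const
  have h1 := hG.circleAverage_poissonKernel_smul hw
  have h2 := Complex.reCLM.circleAverage_comp_comm (hGc.circleIntegrable hR.le)
  rw [h1] at h2
  have h3 : Complex.reCLM (G w) = ‖F w‖ ^ 2 := by
    have : G w = ((‖F w‖ ^ 2 : ℝ) : ℂ) := by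
      have := Complex.conj_mul' (F w)
      simp only [hGdef]
      push_cast
      linear_combination this
    rw [this]; simp [-Complex.ofReal_pow]
  rw [← h3, ← h2]
  refine Real.circleAverage_mono ?_ ?_ fun z hz => ?_
  · exact (Complex.continuous_re.comp_continuousOn hGc).circleIntegrable hR.le
  · exact (hP.mul (hFc.norm.pow 2)).circleIntegrable hR.le
  · rw [abs_of_pos hR] at hz
    have hp := poissonKernel_nonneg hw hz
    have : (G z).re ≤ ‖F z‖ ^ 2 := by
      simp only [hGdef, Complex.sq_norm, Complex.normSq_apply, Complex.sub_re, Complex.mul_re,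
        Complex.mul_im, Complex.conj_re, Complex.conj_im, Complex.re_ofNat, Complex.im_ofNat]
      nlinarith [sq_nonneg ((F z).re - (F w).re), sq_nonneg ((F z).im - (F w).im)]
    simpa using mul_le_mul_of_nonneg_left this hp

/-- The Poisson kernel is harmonic in its first variable, so it satisfies the mean value
property along a holomorphic map. -/
theorem circleAverage_poissonKernel_comp {h : ℂ → ℂ} {r R : ℝ} (hr : 0 ≤ r)
    (hh : DifferentiableOn ℂ h (Metric.closedBall 0 r))
    (hm : ∀ z ∈ Metric.closedBall (0 : ℂ) r, h z ∈ Metric.ball (0 : ℂ) R) {ζ : ℂ}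
    (hζ : ζ ∈ Metric.sphere (0 : ℂ) R) :
    Real.circleAverage (fun z => poissonKernel 0 (h z) ζ) 0 r = poissonKernel 0 (h 0) ζ := by
  -- The Poisson kernel is the real part of this function, which is holomorphic in `z` because `h z`
  -- never meets `ζ`.
  set H : ℂ → ℂ := fun z => herglotzRieszKernel 0 (h z) ζ with hH
  have hd : DifferentiableOn ℂ H (Metric.closedBall 0 r) := by
    simp only [hH, herglotzRieszKernel_def, sub_zero]
    refine (hh.const_add ζ).div (hh.const_sub ζ) fun z hz => ?_
    have h1 := hm z hz
    rw [mem_ball_zero_iff] at h1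
    rw [mem_sphere_zero_iff_norm] at hζ
    rw [sub_ne_zero]
    rintro rfl
    exact h1.ne hζ
  have h1 : DiffContOnCl ℂ H (Metric.ball 0 |r|) := by
    rw [abs_of_nonneg hr]
    exact ⟨hd.mono Metric.ball_subset_closedBall,
      hd.continuousOn.mono Metric.closure_ball_subset_closedBall⟩
  have h2 := Complex.reCLM.circleAverage_comp_comm
    ((hd.continuousOn.mono Metric.sphere_subset_closedBall).circleIntegrable hr)
  rw [h1.circleAverage] at h2
  simp only [poissonKernel_eq_re_herglotzRieszKernel]
  exact h2

theorem circleAverage_circleAverage_swap {g : ℂ → ℂ → ℝ} {r R : ℝ}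
    (hg : Continuous fun p : ℝ × ℝ => g (circleMap 0 r p.1) (circleMap 0 R p.2)) :
    Real.circleAverage (fun z => Real.circleAverage (fun ζ => g z ζ) 0 R) 0 r =
      Real.circleAverage (fun ζ => Real.circleAverage (fun z => g z ζ) 0 r) 0 R := by
  simp only [Real.circleAverage_def, smul_eq_mul, intervalIntegral.integral_const_mul]
  rw [MeasureTheory.intervalIntegral_intervalIntegral_swap]
  exact (hg.continuousOn.integrableOn_compact (isCompact_uIcc.prod isCompact_uIcc)).mono_set
    (Set.prod_mono Set.uIoc_subset_uIcc Set.uIoc_subset_uIcc)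

/-- Littlewood subordination: the mean of `|F ∘ h|²` is bounded by the Poisson integral of `|F|²`
at `h 0`. -/
theorem circleAverage_norm_sq_comp_le {F h : ℂ → ℂ} {r R : ℝ} (hr : 0 ≤ r)
    (hF : DiffContOnCl ℂ F (Metric.ball 0 R))
    (hh : DifferentiableOn ℂ h (Metric.closedBall 0 r))
    (hm : ∀ z ∈ Metric.closedBall (0 : ℂ) r, h z ∈ Metric.ball (0 : ℂ) R) :
    Real.circleAverage (fun z => ‖F (h z)‖ ^ 2) 0 r ≤
      Real.circleAverage (fun ζ => poissonKernel 0 (h 0) ζ * ‖F ζ‖ ^ 2) 0 R := by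
  have hR : 0 < R := Metric.pos_of_mem_ball (hm 0 (by simpa using hr))
  have hcl : closure (Metric.ball (0 : ℂ) R) = Metric.closedBall 0 R := closure_ball 0 hR.ne'
  have hmap : ∀ θ, circleMap 0 r θ ∈ Metric.closedBall (0 : ℂ) r :=
    circleMap_mem_closedBall 0 hr
  have hhθ : Continuous fun θ => h (circleMap 0 r θ) :=
    hh.continuousOn.comp_continuous (continuous_circleMap _ _) hmap
  have hFθ : Continuous fun θ => F (circleMap 0 R θ) :=
    hF.2.comp_continuous (continuous_circleMap _ _) fun θ => by
      rw [hcl]; exact circleMap_mem_closedBall 0 hR.le θ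
  have hFh : ContinuousOn (fun z => ‖F (h z)‖ ^ 2) (Metric.sphere 0 r) := by
    refine (ContinuousOn.norm ?_).pow 2
    refine hF.2.comp (hh.continuousOn.mono Metric.sphere_subset_closedBall) fun z hz => ?_
    exact subset_closure (hm z (Metric.sphere_subset_closedBall hz))
  have hc : Continuous fun p : ℝ × ℝ =>
      poissonKernel 0 (h (circleMap 0 r p.1)) (circleMap 0 R p.2) *
        ‖F (circleMap 0 R p.2)‖ ^ 2 := by
    refine Continuous.mul ?_ ((hFθ.comp continuous_snd).norm.pow 2)
    simp only [poissonKernel_def, sub_zero]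
    have h1 : Continuous fun p : ℝ × ℝ => h (circleMap 0 r p.1) := hhθ.comp continuous_fst
    have h2 : Continuous fun p : ℝ × ℝ => circleMap 0 R p.2 :=
      (continuous_circleMap _ _).comp continuous_snd
    refine ((h2.norm.pow 2).sub (h1.norm.pow 2)).div ((h2.sub h1).norm.pow 2) fun p => ?_
    refine pow_ne_zero 2 (norm_ne_zero_iff.2 (sub_ne_zero.2 ?_))
    exact circleMap_ne_mem_ball (hm _ (hmap _)) _
  calc Real.circleAverage (fun z => ‖F (h z)‖ ^ 2) 0 r
      ≤ Real.circleAverage (fun z =>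
          Real.circleAverage (fun ζ => poissonKernel 0 (h z) ζ * ‖F ζ‖ ^ 2) 0 R) 0 r := by
        refine Real.circleAverage_mono (hFh.circleIntegrable hr) ?_ fun z hz => ?_
        · refine Continuous.intervalIntegrable ?_ _ _
          simp only [Real.circleAverage_def]
          refine Continuous.const_smul (M := ℝ) (α := ℝ) ?_ _
          exact intervalIntegral.continuous_parametric_intervalIntegral_of_continuous' hc _ _
        · rw [abs_of_nonneg hr] at hz
          exact norm_sq_le_circleAverage_poissonKernel hF
            (hm z (Metric.sphere_subset_closedBall hz))
    _ = Real.circleAverage (fun ζ =>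
          Real.circleAverage (fun z => poissonKernel 0 (h z) ζ * ‖F ζ‖ ^ 2) 0 r) 0 R :=
        circleAverage_circleAverage_swap hc
    _ = _ := by
        refine Real.circleAverage_congr_sphere fun ζ hζ => ?_
        rw [abs_of_pos hR] at hζ
        have := Real.circleAverage_fun_smul (a := ‖F ζ‖ ^ 2)
          (f := fun z => poissonKernel 0 (h z) ζ) (c := 0) (R := r)
        simp only [smul_eq_mul] at this
        simp only [mul_comm _ (‖F ζ‖ ^ 2)]
        rw [this, circleAverage_poissonKernel_comp hr hh hm hζ]

/-! ### Weighted subordination -/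

/-- On the circle `R² = ζ * conj ζ`, so `ζ` factors out. The factor `‖ζ - a‖²` is the denominator of
the Poisson kernel at `a`. -/
theorem norm_sq_sub_conj_mul_of_mem_sphere {a ζ : ℂ} {R : ℝ} (hζ : ζ ∈ Metric.sphere (0 : ℂ) R) :
    ‖(R : ℂ) ^ 2 - conj a * ζ‖ ^ 2 = R ^ 2 * ‖ζ - a‖ ^ 2 := by
  rw [mem_sphere_zero_iff_norm] at hζ
  have h1 : (R : ℂ) ^ 2 - conj a * ζ = ζ * conj (ζ - a) := by
    rw [map_sub, mul_sub, Complex.mul_conj', hζ]; ring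
  rw [h1, norm_mul, RCLike.norm_conj, hζ, mul_pow]

/-- A weighted form of Littlewood subordination that does not need `h 0 = 0`. -/
theorem circleAverage_weighted_norm_sq_comp_le {f h : ℂ → ℂ} {r R : ℝ} (hr : 0 ≤ r)
    (hf : DiffContOnCl ℂ f (Metric.ball 0 R))
    (hh : DifferentiableOn ℂ h (Metric.closedBall 0 r))
    (hm : ∀ z ∈ Metric.closedBall (0 : ℂ) r, h z ∈ Metric.ball (0 : ℂ) R) :
    Real.circleAverage (fun z => ‖(R : ℂ) ^ 2 - conj (h 0) * h z‖ ^ 2 * ‖f (h z)‖ ^ 2) 0 r ≤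
      R ^ 2 * (R ^ 2 - ‖h 0‖ ^ 2) * Real.circleAverage (fun ζ => ‖f ζ‖ ^ 2) 0 R := by
  have h0 := hm 0 (by simpa using hr)
  have hR : 0 < R := Metric.pos_of_mem_ball h0
  have hF : DiffContOnCl ℂ (fun z => ((R : ℂ) ^ 2 - conj (h 0) * z) • f z) (Metric.ball 0 R) := by
    refine DiffContOnCl.smul ?_ hf
    exact Differentiable.diffContOnCl (by fun_prop)
  have key := circleAverage_norm_sq_comp_le hr hF hh hm
  simp only [smul_eq_mul, norm_mul, mul_pow] at key
  refine key.trans_eq ?_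
  rw [← smul_eq_mul (a := R ^ 2 * (R ^ 2 - ‖h 0‖ ^ 2)), ← Real.circleAverage_fun_smul]
  refine Real.circleAverage_congr_sphere fun ζ hζ => ?_
  rw [abs_of_pos hR] at hζ
  have hne : ‖ζ - h 0‖ ≠ 0 := by
    refine norm_ne_zero_iff.2 (sub_ne_zero.2 ?_)
    rintro rfl
    rw [mem_ball_zero_iff] at h0
    rw [mem_sphere_zero_iff_norm] at hζ
    exact h0.ne hζ
  simp only [norm_sq_sub_conj_mul_of_mem_sphere hζ, poissonKernel_def, sub_zero,
    mem_sphere_zero_iff_norm.1 hζ, smul_eq_mul]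
  field_simp

/-! ### Composition on the disc and the limit `R → 1` -/

theorem zeroExtend_of_norm_lt {f : 𝔻 → ℂ} {z : ℂ} (hz : ‖z‖ < 1) :
    zeroExtend f z = f (Complex.UnitDisc.mk z hz) := dif_pos hz

/-- No condition on `z` is needed, since the default value `0` also lies in the disc. -/
theorem norm_zeroExtend_coe_lt_one (φ : 𝔻 → 𝔻) (z : ℂ) :
    ‖zeroExtend (fun z => (φ z : ℂ)) z‖ < 1 := by
  unfold zeroExtend
  split_ifs
  · exact Complex.UnitDisc.norm_lt_one _
  · simp

/-- Outside the disc this can fail: the left side is `0`, the right side `f 0`. -/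
theorem zeroExtend_comp {φ : 𝔻 → 𝔻} (f : 𝔻 → ℂ) {z : ℂ} (hz : ‖z‖ < 1) :
    zeroExtend (fun z => f (φ z)) z = zeroExtend f (zeroExtend (fun z => (φ z : ℂ)) z) := by
  rw [zeroExtend_of_norm_lt hz, zeroExtend_of_norm_lt hz, zeroExtend_coe]

theorem IsHolomorphicOnDisc.comp {φ : 𝔻 → 𝔻} (hφ : IsHolomorphicOnDisc fun z => (φ z : ℂ))
    {f : 𝔻 → ℂ} (hf : IsHolomorphicOnDisc f) : IsHolomorphicOnDisc fun z => f (φ z) := by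
  refine (DifferentiableOn.comp hf hφ fun z _ => ?_).congr fun z hz =>
    zeroExtend_comp f (mem_ball_zero_iff.1 hz)
  exact mem_ball_zero_iff.2 (norm_zeroExtend_coe_lt_one φ z)

/-- The weighted subordination inequality against the `H²` norm. -/
theorem MemHardy.circleAverage_weighted_comp_le {φ : 𝔻 → 𝔻}
    (hφ : IsHolomorphicOnDisc fun z => (φ z : ℂ)) {f : 𝔻 → ℂ} (hf : MemHardy f) {r : ℝ}
    (hr : r ∈ Set.Ico (0 : ℝ) 1) :
    Real.circleAverage (fun z => ‖1 - conj (φ 0 : ℂ) * zeroExtend (fun z => (φ z : ℂ)) z‖ ^ 2 *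
      ‖zeroExtend (fun z => f (φ z)) z‖ ^ 2) 0 r ≤ (1 - ‖(φ 0 : ℂ)‖ ^ 2) * hardyNorm f ^ 2 := by
  set h := zeroExtend fun z => (φ z : ℂ) with hdef
  have h0 : h 0 = φ 0 := by
    rw [hdef, ← Complex.UnitDisc.coe_zero, zeroExtend_coe]
  have hsub : Metric.closedBall (0 : ℂ) r ⊆ Metric.ball 0 1 := Metric.closedBall_subset_ball hr.2
  have hh : DifferentiableOn ℂ h (Metric.closedBall 0 r) := hφ.mono hsub
  -- The maximum of `|φ|` on `|z| ≤ r` is below `1`, which leaves room for radii `R` between it and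
  -- `1`.
  obtain ⟨z₀, -, hz₀⟩ := (isCompact_closedBall (0 : ℂ) r).exists_isMaxOn
    ⟨0, by simpa using hr.1⟩ hh.continuousOn.norm
  have hz₀1 : ‖h z₀‖ < 1 := norm_zeroExtend_coe_lt_one φ z₀
  have hfh : Continuous fun θ => zeroExtend f (h (circleMap 0 r θ)) := by
    refine hf.1.continuousOn.comp_continuous
      (hh.continuousOn.comp_continuous (continuous_circleMap _ _)
        (circleMap_mem_closedBall 0 hr.1)) fun θ => ?_
    exact mem_ball_zero_iff.2 (norm_zeroExtend_coe_lt_one φ _)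
  have hhθ : Continuous fun θ => h (circleMap 0 r θ) :=
    hh.continuousOn.comp_continuous (continuous_circleMap _ _) (circleMap_mem_closedBall 0 hr.1)
  -- Here `R` enters only through the polynomial weight: `f` is evaluated at `h z`, inside the disc,
  -- so the limit is harmless.
  have hcont : Continuous fun R : ℝ => Real.circleAverage (fun z =>
      ‖(R : ℂ) ^ 2 - conj (φ 0 : ℂ) * h z‖ ^ 2 * ‖zeroExtend f (h z)‖ ^ 2) 0 r := by
    simp only [Real.circleAverage_def]
    refine Continuous.const_smul (M := ℝ) (α := ℝ) ?_ _
    refine intervalIntegral.continuous_parametric_intervalIntegral_of_continuous' ?_ _ _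
    refine Continuous.mul ?_ ((hfh.comp continuous_snd).norm.pow 2)
    have h1 : Continuous fun p : ℝ × ℝ => h (circleMap 0 r p.2) := hhθ.comp continuous_snd
    have h2 : Continuous fun p : ℝ × ℝ => (p.1 : ℂ) :=
      Complex.continuous_ofReal.comp continuous_fst
    exact ((h2.pow 2).sub (continuous_const.mul h1)).norm.pow 2
  have hcont' : Continuous fun R : ℝ =>
      R ^ 2 * (R ^ 2 - ‖(φ 0 : ℂ)‖ ^ 2) * hardyNorm f ^ 2 := by fun_prop
  have hle : ∀ᶠ R : ℝ in nhdsWithin 1 (Set.Iio 1), Real.circleAverage (fun z =>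
      ‖(R : ℂ) ^ 2 - conj (φ 0 : ℂ) * h z‖ ^ 2 * ‖zeroExtend f (h z)‖ ^ 2) 0 r ≤
      R ^ 2 * (R ^ 2 - ‖(φ 0 : ℂ)‖ ^ 2) * hardyNorm f ^ 2 := by
    filter_upwards [Ioo_mem_nhdsLT hz₀1] with R hR
    have hm : ∀ z ∈ Metric.closedBall (0 : ℂ) r, h z ∈ Metric.ball (0 : ℂ) R := fun z hz =>
      mem_ball_zero_iff.2 ((hz₀ hz).trans_lt hR.1)
    have hR0 : 0 ≤ R := (norm_nonneg _).trans hR.1.le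
    have hfR : DiffContOnCl ℂ (zeroExtend f) (Metric.ball 0 R) :=
      DifferentiableOn.diffContOnCl (hf.1.mono
        (Metric.closure_ball_subset_closedBall.trans (Metric.closedBall_subset_ball hR.2)))
    have key := circleAverage_weighted_norm_sq_comp_le hr.1 hfR hh hm
    rw [h0] at key
    refine key.trans ?_
    have h3 := hm 0 (by simpa using hr.1)
    rw [h0, mem_ball_zero_iff] at h3
    have h4 : 0 ≤ R ^ 2 - ‖(φ 0 : ℂ)‖ ^ 2 := sub_nonneg.2 (by gcongr)
    exact mul_le_mul_of_nonneg_left (hf.squareMean_le ⟨hR0, hR.2⟩) (by positivity)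
  have hlim := le_of_tendsto_of_tendsto (hcont.continuousWithinAt (x := 1))
    (hcont'.continuousWithinAt (x := 1)) hle
  simp only [Complex.ofReal_one, one_pow, one_mul] at hlim
  refine le_trans (le_of_eq (Real.circleAverage_congr_sphere fun z hz => ?_)) hlim
  have hz1 : ‖z‖ < 1 := by
    rw [mem_sphere_zero_iff_norm, abs_of_nonneg hr.1] at hz
    exact hz.trans_lt hr.2
  simp only [zeroExtend_comp f hz1, hdef]

theorem MemHardy.squareMean_comp_le {φ : 𝔻 → 𝔻} (hφ : IsHolomorphicOnDisc fun z => (φ z : ℂ))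
    {f : 𝔻 → ℂ} (hf : MemHardy f) {K : ℝ}
    (hK : ∀ z, ‖(√(1 - ‖(φ 0 : ℂ)‖ ^ 2) : ℂ) / (1 - conj (φ 0 : ℂ) * (φ z : ℂ))‖ ≤ K) {r : ℝ}
    (hr : r ∈ Set.Ico (0 : ℝ) 1) :
    squareMean (fun z => f (φ z)) r ≤ (K * hardyNorm f) ^ 2 := by
  set a : ℂ := (φ 0 : ℂ)
  have ha : 0 < 1 - ‖a‖ ^ 2 := sub_pos.2 (Complex.UnitDisc.sq_norm_lt_one _)
  have hg := IsHolomorphicOnDisc.comp hφ hf.1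
  have hφr : ContinuousOn (zeroExtend fun z => (φ z : ℂ)) (Metric.sphere 0 r) :=
    hφ.continuousOn.mono fun z hz => by
      rw [Metric.mem_ball, Metric.mem_sphere.1 hz]; exact hr.2
  have hgr : ContinuousOn (zeroExtend fun z => f (φ z)) (Metric.sphere 0 r) :=
    hg.continuousOn.mono fun z hz => by
      rw [Metric.mem_ball, Metric.mem_sphere.1 hz]; exact hr.2
  -- This is `hK` squared and cleared of its denominator; it trades the weight in `key` for the
  -- constant `K²`.
  have hpt : ∀ z : 𝔻, 1 - ‖a‖ ^ 2 ≤ K ^ 2 * ‖1 - conj a * (φ z : ℂ)‖ ^ 2 := by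
    intro z
    have hne : 1 - conj a * (φ z : ℂ) ≠ 0 := by
      refine sub_ne_zero.2 fun h => ?_
      have h1 : ‖conj a * (φ z : ℂ)‖ < 1 := by
        rw [norm_mul, RCLike.norm_conj]
        exact mul_lt_one_of_nonneg_of_lt_one_left (norm_nonneg _)
          (Complex.UnitDisc.norm_lt_one _) (Complex.UnitDisc.norm_lt_one _).le
      rw [← h] at h1
      simp at h1
    have h1 := hK z
    rw [norm_div, div_le_iff₀ (norm_pos_iff.2 hne), Complex.norm_real, Real.norm_eq_abs,
      abs_of_nonneg (Real.sqrt_nonneg _)] at h1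
    rw [← mul_pow, ← Real.sq_sqrt ha.le]
    gcongr
  have key := hf.circleAverage_weighted_comp_le hφ hr
  have h1 : (1 - ‖a‖ ^ 2) * squareMean (fun z => f (φ z)) r ≤
      K ^ 2 * ((1 - ‖a‖ ^ 2) * hardyNorm f ^ 2) := by
    refine le_trans ?_ (mul_le_mul_of_nonneg_left key (sq_nonneg K))
    rw [squareMean, ← smul_eq_mul, ← smul_eq_mul (a := K ^ 2), ← Real.circleAverage_fun_smul,
      ← Real.circleAverage_fun_smul]
    refine Real.circleAverage_mono ?_ ?_ fun z hz => ?_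
    · exact (hg.circleIntegrable hr).const_fun_smul
    · refine CircleIntegrable.const_fun_smul ?_
      refine ContinuousOn.circleIntegrable hr.1 ?_
      exact ((continuousOn_const.sub (continuousOn_const.mul hφr)).norm.pow 2).mul
        (hgr.norm.pow 2)
    · have hz1 : ‖z‖ < 1 := by
        rw [mem_sphere_zero_iff_norm, abs_of_nonneg hr.1] at hz
        exact hz.trans_lt hr.2
      simp only [smul_eq_mul, ← mul_assoc]
      rw [zeroExtend_of_norm_lt (f := fun z => (φ z : ℂ)) hz1]
      exact mul_le_mul_of_nonneg_right (hpt _) (by positivity)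
  have h2 : (1 - ‖a‖ ^ 2) * squareMean (fun z => f (φ z)) r ≤
      (1 - ‖a‖ ^ 2) * (K * hardyNorm f) ^ 2 := h1.trans_eq (by ring)
  exact le_of_mul_le_mul_left h2 ha

/-- The elementary bound on the normalized reproducing kernel of `H²`. -/
theorem norm_sqrt_div_one_sub_conj_mul_le (a w : 𝔻) :
    ‖(√(1 - ‖(a : ℂ)‖ ^ 2) : ℂ) / (1 - conj (a : ℂ) * (w : ℂ))‖ ≤
      √((1 + ‖(a : ℂ)‖) / (1 - ‖(a : ℂ)‖)) := by
  have ha : 0 < 1 - ‖(a : ℂ)‖ := sub_pos.2 a.norm_lt_one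
  have h1 : 1 - ‖(a : ℂ)‖ ≤ ‖1 - conj (a : ℂ) * (w : ℂ)‖ := by
    have h2 := norm_sub_norm_le (1 : ℂ) (conj (a : ℂ) * (w : ℂ))
    rw [norm_one, norm_mul, RCLike.norm_conj] at h2
    have h3 : ‖(a : ℂ)‖ * ‖(w : ℂ)‖ ≤ ‖(a : ℂ)‖ :=
      mul_le_of_le_one_right (norm_nonneg _) w.norm_lt_one.le
    linarith
  rw [norm_div, Complex.norm_real, Real.norm_eq_abs, abs_of_nonneg (Real.sqrt_nonneg _)]
  -- From `1 - |a|² = (1 - |a|)(1 + |a|)`; the claim then reduces to the lower bound `h1` on the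
  -- denominator.
  have h4 : √((1 + ‖(a : ℂ)‖) / (1 - ‖(a : ℂ)‖)) = √(1 - ‖(a : ℂ)‖ ^ 2) / (1 - ‖(a : ℂ)‖) := by
    rw [← Real.sqrt_sq ha.le, ← Real.sqrt_div' _ (sq_nonneg _), Real.sqrt_sq ha.le]
    congr 1
    field_simp
    ring
  rw [h4]
  gcongr

/-! ### The composition operator -/

/-- The composition operator on `H²` as a linear map. -/
def hardyCompositionLinearMap (φ : 𝔻 → 𝔻)
    (h : ∀ f : 𝔻 → ℂ, MemHardy f → MemHardy fun z => f (φ z)) :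
    HardySpace →ₗ[ℂ] HardySpace where
  toFun f := ⟨fun z => f (φ z), h f f.memHardy⟩
  map_add' _ _ := rfl
  map_smul' _ _ := rfl

theorem theorem4p1 (φ : 𝔻 → 𝔻) (hφ : IsHolomorphicOnDisc fun z => (φ z : ℂ)) :
    ∃ C : HardySpace →L[ℂ] HardySpace,
      (∀ (f : HardySpace) (z : 𝔻), C f z = f (φ z)) ∧
      BddAbove (Set.range fun z : 𝔻 =>
        ‖(√(1 - ‖(φ 0 : ℂ)‖ ^ 2) : ℂ) / (1 - conj (φ 0 : ℂ) * (φ z : ℂ))‖) ∧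
      ‖C‖ ≤ ⨆ z : 𝔻, ‖(√(1 - ‖(φ 0 : ℂ)‖ ^ 2) : ℂ) / (1 - conj (φ 0 : ℂ) * (φ z : ℂ))‖ ∧
      (⨆ z : 𝔻, ‖(√(1 - ‖(φ 0 : ℂ)‖ ^ 2) : ℂ) / (1 - conj (φ 0 : ℂ) * (φ z : ℂ))‖) ≤
        √((1 + ‖(φ 0 : ℂ)‖) / (1 - ‖(φ 0 : ℂ)‖)) := by
  have hle := fun z => norm_sqrt_div_one_sub_conj_mul_le (φ 0) (φ z)
  have hb : BddAbove (Set.range fun z : 𝔻 =>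
      ‖(√(1 - ‖(φ 0 : ℂ)‖ ^ 2) : ℂ) / (1 - conj (φ 0 : ℂ) * (φ z : ℂ))‖) :=
    ⟨_, Set.forall_mem_range.2 hle⟩
  have hK := fun z => le_ciSup hb z
  have hK0 := (norm_nonneg _).trans (hK 0)
  have hmem : ∀ f : 𝔻 → ℂ, MemHardy f → MemHardy fun z => f (φ z) := fun f hf =>
    ⟨IsHolomorphicOnDisc.comp hφ hf.1, _, Set.forall_mem_image.2 fun _ hr =>
      hf.squareMean_comp_le hφ hK hr⟩
  have hnorm : ∀ f : HardySpace, ‖hardyCompositionLinearMap φ hmem f‖ ≤ _ * ‖f‖ := fun f =>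
    hardyNorm_le (mul_nonneg hK0 (hardyNorm_nonneg _)) fun _ hr =>
      f.memHardy.squareMean_comp_le hφ hK hr
  exact ⟨(hardyCompositionLinearMap φ hmem).mkContinuous _ hnorm, fun _ _ => rfl, hb,
    LinearMap.mkContinuous_norm_le _ hK0 _, ciSup_le hle⟩
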